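/- Let $\psi(a,c,x)$ denote the Tricomi confluent hypergeometric function of the second kind, for real $a,c$ and $x>0$: the solution of Kummer's equation $xy''+(c-x)y'-ay=0$ that for $a>0$ is given by $$\psi(a,c,x)=\frac{1}{\Gamma(a)}\int_0^\infty e^{-xt}t^{a-1}(1+t)^{c-a-1}\,dt,$$ and that is extended to $a\le 0$ by analytic continuation in the parameters, i.e. by the relation $\psi(a,c,x)=(x-c)\,\psi(a+1,c+1,x)+(a+1)\,x\,\psi(a+2,c+2,x)$. Put $$\Delta_{a,c}(x)=\psi^2(a,c,x)-\psi(a-1,c-1,x)\,\psi(a+1,c+1,x).$$ (i) If $a>0$, $c<1$ and $x>0$, then $$\frac{c-a-1}{x^2}\,\psi^2(a,c,x)<\Delta_{a,c}(x)\qquad\text{and}\qquad -\frac{1}{2x}\,\psi^2(a,c,x)<\Delta_{a,c}(x).$$ Both inequalities are sharp as $x\to\infty$, in the sense that, after division by $\psi^2(a,c,x)$, the two sides have the same limit: $\Delta_{a,c}(x)/\psi^2(a,c,x)\to 0$, $(c-a-1)/x^2\to0$ and $-1/(2x)\to 0$ as $x\to\infty$. For the first inequality moreover $x^2\Delta_{a,c}(x)/\psi^2(a,c,x)\to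 c-a-1$ as $x\to\infty$. (ii) If $a>1$, $c<-1$ and $x>0$, then $$\Delta_{a,c}(x)<\left(\frac1c+2x\,\frac{c-a}{c^2(c+1)}\right)\psi^2(a,c,x).$$ This inequality is sharp as $x\to 0^+$, in the sense that, after division by $\psi^2(a,c,x)$, both sides tend to $1/c$ as $x\to0^+$. -/

import Mathlib

open Filter Topology

noncomputable section

/-- The Tricomi confluent hypergeometric function `ψ(a, c, x)` (also written `U(a, c, x)`),
for real parameters `a`, `c` and real `x > 0`.

For `a > 0` it is given by its convergent integral representation
`ψ(a, c, x) = (1 / Γ(a)) ∫₀^∞ e^{-xt} t^{a-1} (1+t)^{c-a-1} dt`.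
For `a ≤ 0` it is given by analytic continuation in the parameters, by means of the relation
`ψ(a, c, x) = (x - c) ψ(a+1, c+1, x) + (a+1) x ψ(a+2, c+2, x)`,
which holds for all real `a`, `c` and is Kummer's equation `x y'' + (c - x) y' - a y = 0`
rewritten with `ψ'(a, c, x) = -a ψ(a+1, c+1, x)`. -/
def tricomi (a c x : ℝ) : ℝ :=
  if 0 < a then
    1 / Real.Gamma a *
      ∫ t in Set.Ioi (0 : ℝ), Real.exp (-(x * t)) * t ^ (a - 1) * (1 + t) ^ (c - a - 1)
  else
    (x - c) * tricomi (a + 1) (c + 1) x + (a + 1) * x * tricomi (a + 2) (c + 2) x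
termination_by ⌊1 - a⌋₊
decreasing_by
  all_goals
    rename_i h
    have h1 : (1 : ℝ) ≤ 1 - a := by linarith
    have hpos : 0 < ⌊1 - a⌋₊ := Nat.floor_pos.mpr h1
    rw [Nat.floor_lt' hpos.ne']
    have := Nat.lt_floor_add_one (1 - a)
    linarith

/-- The Turánian of the Tricomi function with both parameters shifted,
`ψ²(a, c, x) - ψ(a-1, c-1, x) ψ(a+1, c+1, x)`. -/
def tricomiTuranian (a c x : ℝ) : ℝ :=
  tricomi a c x ^ 2 - tricomi (a - 1) (c - 1) x * tricomi (a + 1) (c + 1) x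

end

/-! Write `u = x ψ(a+1,c+1,x)/ψ(a,c,x)` and `b = 1 - c`. Eliminating `ψ(a-1,c-1,x)` by its
recurrence gives `Δ/ψ² = -q/x` with `q = (x+b)u + au² - x`, and Kummer's equation becomes the
Riccati equation `x u' = q`. Hence `Δ/ψ² = -u'`, and each inequality is a pointwise bound on `q`.
Differentiating `q` gives `q' = q + (u - 1) + (b + 2au) q/x`. If `q` once reached a proposed upper
bound `p`, this equation and `0 < u < 1` would make `(q - p)e^{-x}` increase forever, although it is
dominated by a function tending to `0`. This comparison (`neg_of_deriv_pos_of_le_tendsto_zero`) is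
run with `p = (a+b)/x` and `p = 1/2`, and with signs reversed for a quadratic lower bound. The
limits at infinity follow from `x^a ∫ e^{-xt} t^{a-1} (1+t)^e dt → Γ(a)`; the limit at `0` is a
squeeze. -/

/-! ### Laplace-type integrals: positivity, derivative, contiguous relations. -/

open MeasureTheory in
theorem kummerIntegrand_aestronglyMeasurable (a e x : ℝ) :
    AEStronglyMeasurable (fun t : ℝ => Real.exp (-(x * t)) * t ^ (a - 1) * (1 + t) ^ e)
      (volume.restrict (Set.Ioi 0)) := by
  refine Measurable.aestronglyMeasurable ?_
  fun_prop

open MeasureTheory in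
theorem exp_mul_rpow_integrableOn {a x : ℝ} (ha : 0 < a) (hx : 0 < x) :
    IntegrableOn (fun t : ℝ => Real.exp (-(x * t)) * t ^ (a - 1)) (Set.Ioi 0) := by
  have h := integrableOn_rpow_mul_exp_neg_mul_rpow (p := 1) (s := a - 1) (b := x)
    (by linarith) one_pos hx
  refine h.congr_fun (fun t ht => ?_) measurableSet_Ioi
  simp only [Real.rpow_one, neg_mul]
  ring

open MeasureTheory in
theorem kummerIntegrand_integrableOn {a e x : ℝ} (ha : 0 < a) (he : e ≤ 0) (hx : 0 < x) :
    IntegrableOn (fun t : ℝ => Real.exp (-(x * t)) * t ^ (a - 1) * (1 + t) ^ e) (Set.Ioi 0) := by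
  refine (exp_mul_rpow_integrableOn ha hx).mono' (kummerIntegrand_aestronglyMeasurable a e x) ?_
  refine (ae_restrict_iff' measurableSet_Ioi).mpr (ae_of_all _ fun t ht => ?_)
  have ht : 0 < t := ht
  have h1 : (1 + t) ^ e ≤ 1 := Real.rpow_le_one_of_one_le_of_nonpos (by linarith) he
  have h2 : 0 ≤ Real.exp (-(x * t)) * t ^ (a - 1) := by positivity
  rw [Real.norm_of_nonneg (by positivity)]
  exact mul_le_of_le_one_right h2 h1

/-- The unnormalised integral `∫₀^∞ e^{-xt} t^{a-1} (1+t)^e dt`. -/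
noncomputable def kummerIntegral (a e x : ℝ) : ℝ :=
  ∫ t in Set.Ioi (0 : ℝ), Real.exp (-(x * t)) * t ^ (a - 1) * (1 + t) ^ e

open MeasureTheory in
theorem kummerIntegral_pos {a e x : ℝ} (ha : 0 < a) (he : e ≤ 0) (hx : 0 < x) :
    0 < kummerIntegral a e x := by
  unfold kummerIntegral
  have hp : ∀ t ∈ Set.Ioi (0 : ℝ), 0 < Real.exp (-(x * t)) * t ^ (a - 1) * (1 + t) ^ e := by
    intro t ht
    have ht : 0 < t := ht
    positivity
  rw [setIntegral_pos_iff_support_of_nonneg_ae]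
  · rw [Set.inter_eq_self_of_subset_right]
    · simp
    · intro t ht
      exact (hp t ht).ne'
  · exact (ae_restrict_iff' measurableSet_Ioi).mpr (ae_of_all _ fun t ht => (hp t ht).le)
  · exact kummerIntegrand_integrableOn ha he hx

open MeasureTheory in
theorem kummerIntegral_hasDerivAt {a e x : ℝ} (ha : 0 < a) (he : e ≤ 0) (hx : 0 < x) :
    HasDerivAt (kummerIntegral a e) (-kummerIntegral (a + 1) e x) x := by
  have h := hasDerivAt_integral_of_dominated_loc_of_deriv_le
    (μ := volume.restrict (Set.Ioi (0 : ℝ))) (x₀ := x) (s := Set.Ioi (x / 2))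
    (F := fun x t => Real.exp (-(x * t)) * t ^ (a - 1) * (1 + t) ^ e)
    (F' := fun x t => -(Real.exp (-(x * t)) * t ^ (a + 1 - 1) * (1 + t) ^ e))
    (bound := fun t => Real.exp (-(x / 2 * t)) * t ^ (a + 1 - 1) * (1 + t) ^ e)
    -- On `y > x/2` the differentiated integrand is dominated by its value at `x/2`.
    (Ioi_mem_nhds (by linarith))
    (Eventually.of_forall fun y => kummerIntegrand_aestronglyMeasurable a e y)
    (kummerIntegrand_integrableOn ha he hx)
    (kummerIntegrand_aestronglyMeasurable (a + 1) e x).neg ?_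
    (kummerIntegrand_integrableOn (by linarith) he (by linarith)) ?_
  · have h2 := h.2
    rw [integral_neg] at h2
    exact h2
  · refine (ae_restrict_iff' measurableSet_Ioi).mpr (ae_of_all _ fun t ht y hy => ?_)
    have ht : 0 < t := ht
    have hy : x / 2 < y := hy
    rw [norm_neg, Real.norm_of_nonneg (by positivity)]
    gcongr
  · refine (ae_restrict_iff' measurableSet_Ioi).mpr (ae_of_all _ fun t ht y hy => ?_)
    have ht : 0 < t := ht
    have h1 : HasDerivAt (fun y : ℝ => Real.exp (-(y * t))) (Real.exp (-(y * t)) * -(1 * t)) y :=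
      (((hasDerivAt_id y).mul_const t).neg).exp
    have h2 := (h1.mul_const (t ^ (a - 1))).mul_const ((1 + t) ^ e)
    refine h2.congr_deriv ?_
    have h3 : t ^ (a + 1 - 1) = t ^ (a - 1) * t := by
      rw [← Real.rpow_add_one ht.ne']; congr 1; ring
    rw [h3]; ring

-- Integrate the derivative of `e^{-xt} t^a (1+t)^e`, which vanishes at both ends because `a, x >
-- 0`.
open MeasureTheory in
theorem kummerIntegral_parts {a e x : ℝ} (ha : 0 < a) (he : e ≤ 0) (hx : 0 < x) :
    x * kummerIntegral (a + 1) e x =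
      a * kummerIntegral a e x + e * kummerIntegral (a + 1) (e - 1) x := by
  have i1 := kummerIntegrand_integrableOn (a := a + 1) (by linarith) he hx
  have i2 := kummerIntegrand_integrableOn ha he hx
  have i3 := kummerIntegrand_integrableOn (a := a + 1) (e := e - 1) (by linarith) (by linarith) hx
  have i4 : IntegrableOn (fun t : ℝ => a * (Real.exp (-(x * t)) * t ^ (a - 1) * (1 + t) ^ e)
      + e * (Real.exp (-(x * t)) * t ^ (a + 1 - 1) * (1 + t) ^ (e - 1))) (Set.Ioi 0) :=
    (i2.const_mul a).add (i3.const_mul e)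
  have key := integral_Ioi_of_hasDerivAt_of_tendsto (a := (0 : ℝ)) (m := 0)
    (f := fun t => Real.exp (-(x * t)) * t ^ a * (1 + t) ^ e)
    (f' := fun t => a * (Real.exp (-(x * t)) * t ^ (a - 1) * (1 + t) ^ e)
      + e * (Real.exp (-(x * t)) * t ^ (a + 1 - 1) * (1 + t) ^ (e - 1))
      - x * (Real.exp (-(x * t)) * t ^ (a + 1 - 1) * (1 + t) ^ e)) ?_ ?_ ?_ ?_
  · rw [integral_sub i4 (i1.const_mul x),
      integral_add (i2.const_mul a) (i3.const_mul e), integral_const_mul, integral_const_mul,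
      integral_const_mul] at key
    simp only [Real.zero_rpow ha.ne', mul_zero, zero_mul, sub_zero] at key
    unfold kummerIntegral
    linarith
  · refine ContinuousAt.continuousWithinAt ?_
    refine ContinuousAt.mul (ContinuousAt.mul (by fun_prop) ?_) ?_
    · exact Real.continuousAt_rpow_const _ _ (Or.inr ha.le)
    · exact ContinuousAt.rpow_const (by fun_prop) (Or.inl (by norm_num))
  · intro t ht
    have ht : 0 < t := ht
    have h1 : HasDerivAt (fun t : ℝ => Real.exp (-(x * t))) (Real.exp (-(x * t)) * -(x * 1)) t :=
      (((hasDerivAt_id t).const_mul x).neg).exp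
    have h2 : HasDerivAt (fun t : ℝ => t ^ a) (a * t ^ (a - 1)) t :=
      Real.hasDerivAt_rpow_const (Or.inl ht.ne')
    have h3 : HasDerivAt (fun t : ℝ => (1 + t) ^ e) (1 * e * (1 + t) ^ (e - 1)) t :=
      ((hasDerivAt_id t).const_add 1).rpow_const (Or.inl (by simp; linarith))
    refine ((h1.mul h2).mul h3).congr_deriv ?_
    rw [show a + 1 - 1 = a by ring]
    simp only [Pi.mul_apply]
    ring
  · exact i4.sub (i1.const_mul x)
  · refine squeeze_zero' (g := fun t : ℝ => t ^ a * Real.exp (-x * t)) ?_ ?_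
      (tendsto_rpow_mul_exp_neg_mul_atTop_nhds_zero a x hx)
    · filter_upwards [eventually_gt_atTop 0] with t ht
      positivity
    · filter_upwards [eventually_gt_atTop 0] with t ht
      have h1 : (1 + t) ^ e ≤ 1 := Real.rpow_le_one_of_one_le_of_nonpos (by linarith) he
      have h2 : 0 ≤ Real.exp (-(x * t)) * t ^ a := by positivity
      have h3 := mul_le_of_le_one_right h2 h1
      rw [neg_mul]
      linarith

open MeasureTheory in
theorem kummerIntegral_split {a e x : ℝ} (ha : 0 < a) (he : e ≤ 0) (hx : 0 < x) :
    kummerIntegral a e x = kummerIntegral a (e - 1) x + kummerIntegral (a + 1) (e - 1) x := by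
  unfold kummerIntegral
  rw [← integral_add (kummerIntegrand_integrableOn ha (by linarith) hx)
    (kummerIntegrand_integrableOn (by linarith) (by linarith) hx)]
  refine setIntegral_congr_fun measurableSet_Ioi fun t ht => ?_
  have ht : 0 < t := ht
  have h3 : t ^ (a + 1 - 1) = t ^ (a - 1) * t := by
    rw [← Real.rpow_add_one ht.ne']; congr 1; ring
  have h4 : (1 + t) ^ e = (1 + t) ^ (e - 1) * (1 + t) := by
    rw [← Real.rpow_add_one (by positivity)]; congr 1; ring
  simp only [h3, h4]
  ring

/-- The exponent `e` stays fixed since `c - a - 1` is invariant under shifting `a` and `c` together.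
-/
theorem kummerIntegral_threeTerm {a e x : ℝ} (ha : 1 < a) (he : e ≤ 0) (hx : 0 < x) :
    (a - 1) * kummerIntegral (a - 1) e x =
      (x - e - a) * kummerIntegral a e x + x * kummerIntegral (a + 1) e x := by
  have h1 := kummerIntegral_parts (a := a - 1) (by linarith) he hx
  have h2 := kummerIntegral_parts (a := a) (by linarith) he hx
  have h3 := kummerIntegral_split (a := a) (by linarith) he hx
  rw [sub_add_cancel] at h1
  linear_combination -h1 - h2 + e * h3

/-! ### Leading asymptotics of the integrals at infinity. -/

theorem one_add_mul_le_rpow_of_nonpos {e t : ℝ} (he : e ≤ 0) (ht : 0 ≤ t) :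
    1 + e * t ≤ (1 + t) ^ e := by
  have h1 : Real.log (1 + t) ≤ t := by
    have := Real.log_le_sub_one_of_pos (x := 1 + t) (by linarith)
    linarith
  rw [Real.rpow_def_of_pos (by linarith)]
  have h2 := Real.add_one_le_exp (Real.log (1 + t) * e)
  nlinarith

theorem kummerIntegral_zero {a x : ℝ} (ha : 0 < a) (hx : 0 < x) :
    kummerIntegral a 0 x = (1 / x) ^ a * Real.Gamma a := by
  rw [← Real.integral_rpow_mul_exp_neg_mul_Ioi ha hx]
  simp only [kummerIntegral, Real.rpow_zero, mul_one, mul_comm (Real.exp _)]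

open MeasureTheory in
theorem kummerIntegral_le {a e x : ℝ} (ha : 0 < a) (he : e ≤ 0) (hx : 0 < x) :
    kummerIntegral a e x ≤ kummerIntegral a 0 x := by
  refine setIntegral_mono_on (kummerIntegrand_integrableOn ha he hx)
    (kummerIntegrand_integrableOn ha le_rfl hx) measurableSet_Ioi fun t ht => ?_
  have ht : 0 < t := ht
  have : (1 : ℝ) ≤ 1 + t := by linarith
  gcongr

open MeasureTheory in
theorem le_kummerIntegral {a e x : ℝ} (ha : 0 < a) (he : e ≤ 0) (hx : 0 < x) :
    kummerIntegral a 0 x + e * kummerIntegral (a + 1) 0 x ≤ kummerIntegral a e x := by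
  have i1 := kummerIntegrand_integrableOn ha le_rfl hx
  have i2 := kummerIntegrand_integrableOn (a := a + 1) (by linarith) le_rfl hx
  unfold kummerIntegral
  rw [← integral_const_mul, ← integral_add i1 (i2.const_mul e)]
  refine setIntegral_mono_on (i1.add (i2.const_mul e))
    (kummerIntegrand_integrableOn ha he hx) measurableSet_Ioi fun t ht => ?_
  have ht : 0 < t := ht
  have h3 : t ^ (a + 1 - 1) = t ^ (a - 1) * t := by
    rw [← Real.rpow_add_one ht.ne']; congr 1; ring
  simp only [h3, Real.rpow_zero]
  have h4 : 0 ≤ Real.exp (-(x * t)) * t ^ (a - 1) := by positivity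
  linarith [mul_le_mul_of_nonneg_left (one_add_mul_le_rpow_of_nonpos he ht.le) h4]

/-- From `1 + et ≤ (1+t)^e ≤ 1`, the integral is squeezed between Gamma integrals differing by a
relative `O(1/x)`. -/
theorem tendsto_rpow_mul_kummerIntegral {a e : ℝ} (ha : 0 < a) (he : e ≤ 0) :
    Tendsto (fun x => x ^ a * kummerIntegral a e x) atTop (𝓝 (Real.Gamma a)) := by
  have hz : ∀ {s x : ℝ}, 0 < s → 0 < x → x ^ s * kummerIntegral s 0 x = Real.Gamma s := by
    intro s x hs hx
    rw [kummerIntegral_zero hs hx, ← mul_assoc, ← Real.mul_rpow hx.le (by positivity),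
      mul_one_div_cancel hx.ne', Real.one_rpow, one_mul]
  have hlow : Tendsto (fun x : ℝ => Real.Gamma a + e * Real.Gamma (a + 1) * x⁻¹) atTop
      (𝓝 (Real.Gamma a)) := by
    simpa using (tendsto_inv_atTop_zero.const_mul (e * Real.Gamma (a + 1))).const_add
      (Real.Gamma a)
  refine tendsto_of_tendsto_of_tendsto_of_le_of_le' hlow tendsto_const_nhds ?_ ?_
  · filter_upwards [eventually_gt_atTop 0] with x hx
    have h := mul_le_mul_of_nonneg_left (le_kummerIntegral ha he hx) (Real.rpow_nonneg hx.le a)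
    refine le_trans (le_of_eq ?_) h
    rw [mul_add, hz ha hx, ← hz (s := a + 1) (by linarith) hx, Real.rpow_add_one hx.ne']
    field_simp
  · filter_upwards [eventually_gt_atTop 0] with x hx
    have h := mul_le_mul_of_nonneg_left (kummerIntegral_le ha he hx) (Real.rpow_nonneg hx.le a)
    rwa [hz ha hx] at h

theorem tendsto_mul_kummerIntegral_div {a e e' : ℝ} (ha : 0 < a) (he : e ≤ 0) (he' : e' ≤ 0) :
    Tendsto (fun x => x * (kummerIntegral (a + 1) e' x / kummerIntegral a e x)) atTop (𝓝 a) := by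
  have hG := Real.Gamma_pos_of_pos ha
  have h := (tendsto_rpow_mul_kummerIntegral (a := a + 1) (by linarith) he').div
    (tendsto_rpow_mul_kummerIntegral ha he) hG.ne'
  rw [Real.Gamma_add_one ha.ne', mul_div_cancel_right₀ _ hG.ne'] at h
  refine h.congr' ?_
  filter_upwards [eventually_gt_atTop 0] with x hx
  have h1 := kummerIntegral_pos ha he hx
  have h2 : 0 < x ^ a := by positivity
  simp only [Pi.div_apply]
  rw [Real.rpow_add_one hx.ne']
  field_simp

/-! ### Comparison argument for the Riccati equation. -/

/-- Once nonnegative, `F` cannot cross zero downwards, so it increases strictly from then on and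
stays above a positive constant, which `G → 0` forbids. -/
theorem neg_of_deriv_pos_of_le_tendsto_zero {F F' G : ℝ → ℝ}
    (hF : ∀ x, 0 < x → HasDerivAt F (F' x) x) (hpos : ∀ x, 0 < x → 0 ≤ F x → 0 < F' x)
    (hle : ∀ x, 0 < x → F x ≤ G x) (hG : Tendsto G atTop (𝓝 0)) {x : ℝ} (hx : 0 < x) :
    F x < 0 := by
  by_contra! h0
  have hnn : ∀ y, x ≤ y → 0 ≤ F y := by
    intro y hy
    have h := image_le_of_deriv_right_lt_deriv_boundary (f := fun t => -F t)
      (f' := fun t => -F' t) (B := fun _ => 0) (B' := fun _ => 0) (a := x) (b := y)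
      (fun t ht => (hF t (hx.trans_le ht.1)).continuousAt.neg.continuousWithinAt)
      (fun t ht => (hF t (hx.trans_le ht.1)).neg.hasDerivWithinAt)
      (by simpa using h0) (fun t => hasDerivAt_const t 0)
      (fun t ht hFt => by
        have := hpos t (hx.trans_le ht.1) (by simp at hFt; exact hFt.ge)
        simpa using this)
    simpa using h ⟨hy, le_rfl⟩
  have hmono : StrictMonoOn F (Set.Ici x) := by
    refine strictMonoOn_of_deriv_pos (convex_Ici x)
      (fun t ht => (hF t (hx.trans_le ht)).continuousAt.continuousWithinAt) fun t ht => ?_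
    rw [interior_Ici] at ht
    have ht : x < t := ht
    rw [(hF t (hx.trans ht)).deriv]
    exact hpos t (hx.trans ht) (hnn t ht.le)
  have h1 : 0 < F (x + 1) :=
    h0.trans_lt (hmono (Set.mem_Ici.2 le_rfl) (Set.mem_Ici.2 (by linarith)) (by linarith))
  have h2 : ∀ᶠ y in atTop, F (x + 1) ≤ G y := by
    filter_upwards [eventually_ge_atTop (x + 1)] with y hy
    exact (hmono.monotoneOn (Set.mem_Ici.2 (by linarith)) (Set.mem_Ici.2 (by linarith)) hy).trans
      (hle y (by linarith))
  exact absurd (ge_of_tendsto hG h2) (not_le.2 h1)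

/-- The numerator of the right-hand side of the Riccati equation for `x ψ(a+1,c+1,x)/ψ(a,c,x)`. -/
def riccatiRHS (a b x u : ℝ) : ℝ := (x + b) * u + a * u ^ 2 - x

/-- The factor `e^{-x}` absorbs the term `+q` in `q'`; it also supplies the decay needed at
infinity. -/
theorem riccati_sub_mul_exp_hasDerivAt {a b x p' : ℝ} {u p : ℝ → ℝ} (hx : 0 < x)
    (hu : HasDerivAt u (riccatiRHS a b x (u x) / x) x) (hp : HasDerivAt p p' x) :
    HasDerivAt (fun x => (riccatiRHS a b x (u x) - p x) * Real.exp (-x))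
      ((u x - 1 + (b + 2 * a * u x) * (riccatiRHS a b x (u x) / x) - p' + p x) *
        Real.exp (-x)) x := by
  have h1 := ((((hasDerivAt_id x).add_const b).mul hu).add ((hu.pow 2).const_mul a)).sub
    (hasDerivAt_id x)
  have h2 : HasDerivAt (fun x : ℝ => Real.exp (-x)) (Real.exp (-x) * -1) x :=
    (hasDerivAt_id x).neg.exp
  refine ((h1.sub hp).mul h2).congr_deriv ?_
  simp only [riccatiRHS, id, Pi.sub_apply, Pi.add_apply, Pi.mul_apply, Pi.pow_apply]
  field_simp
  ring

theorem riccatiRHS_lt {a b : ℝ} (ha : 0 < a) (hb : 0 < b) {u p p' : ℝ → ℝ}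
    (hu : ∀ x, 0 < x → HasDerivAt u (riccatiRHS a b x (u x) / x) x)
    (hu1 : ∀ x, 0 < x → u x < 1) (hu0 : ∀ x, 0 < x → 0 < u x)
    (hp : ∀ x, 0 < x → HasDerivAt p (p' x) x) (hp0 : ∀ x, 0 < x → 0 ≤ p x)
    (hstep : ∀ x, 0 < x → p x ≤ riccatiRHS a b x (u x) →
      0 < u x - 1 + (b + 2 * a * u x) * (riccatiRHS a b x (u x) / x) - p' x + p x)
    {x : ℝ} (hx : 0 < x) : riccatiRHS a b x (u x) < p x := by
  have hG : Tendsto (fun x : ℝ => (a + b) * Real.exp (-x)) atTop (𝓝 0) := by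
    simpa using Real.tendsto_exp_neg_atTop_nhds_zero.const_mul (a + b)
  have h := neg_of_deriv_pos_of_le_tendsto_zero
    (fun x hx => riccati_sub_mul_exp_hasDerivAt hx (hu x hx) (hp x hx))
    (fun x hx hF => ?_) (fun x hx => ?_) hG hx
  · by_contra! h0
    have : 0 ≤ (riccatiRHS a b x (u x) - p x) * Real.exp (-x) :=
      mul_nonneg (by linarith) (Real.exp_pos _).le
    linarith
  · refine mul_pos (hstep x hx ?_) (Real.exp_pos _)
    have := nonneg_of_mul_nonneg_left hF (Real.exp_pos _)
    linarith
  -- Here `q - p ≤ q = -x(1-u) + bu + au² ≤ a + b`.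
  · gcongr
    have h1 := hu1 x hx
    have h2 := hu0 x hx
    have h3 := hp0 x hx
    unfold riccatiRHS
    nlinarith [mul_pos hx (sub_pos.2 h1), mul_pos hb (sub_pos.2 h1), mul_pos ha h2,
      mul_pos (mul_pos ha h2) (sub_pos.2 h1)]

theorem riccatiRHS_lt_div {a b : ℝ} (ha : 0 < a) (hb : 0 < b) {u : ℝ → ℝ}
    (hu : ∀ x, 0 < x → HasDerivAt u (riccatiRHS a b x (u x) / x) x)
    (hu1 : ∀ x, 0 < x → u x < 1) (hu0 : ∀ x, 0 < x → 0 < u x) {x : ℝ} (hx : 0 < x) :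
    riccatiRHS a b x (u x) < (a + b) / x := by
  refine riccatiRHS_lt (p := fun x => (a + b) / x) (p' := fun x => -((a + b) / x ^ 2)) ha hb hu hu1
    hu0 (fun x hx => ?_) (fun x hx => by positivity) (fun x hx hq => ?_) hx
  · have := (hasDerivAt_inv hx.ne').const_mul (a + b)
    simp only [div_eq_mul_inv]
    refine this.congr_deriv ?_
    ring
  · have h1 := hu1 x hx
    have h0 := hu0 x hx
    have hq0 : 0 < riccatiRHS a b x (u x) := lt_of_lt_of_le (by positivity) hq
    have hterm : 0 < (b + 2 * a * u x) * (riccatiRHS a b x (u x) / x) := by positivity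
    rw [div_le_iff₀ hx] at hq
    unfold riccatiRHS at hq
    -- Dividing by `x²` gives `1 - u < p - p'` for `p = (a+b)/x`.
    have key : x ^ 2 * (1 - u x) < (a + b) + (a + b) * x := by
      nlinarith [mul_pos hx (sub_pos.2 h1), mul_pos (mul_pos ha hx) (sub_pos.2 h1),
        mul_pos (mul_pos hb hx) (sub_pos.2 h1), mul_pos (mul_pos (mul_pos ha hx) h0) (sub_pos.2 h1)]
    have h3 : 1 - u x < (a + b) / x ^ 2 + (a + b) / x := by
      rw [show (a + b) / x ^ 2 + (a + b) / x = ((a + b) + (a + b) * x) / x ^ 2 by field_simp,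
        lt_div_iff₀ (by positivity)]
      linarith
    linarith

theorem riccatiRHS_lt_half {a b : ℝ} (ha : 0 < a) (hb : 0 < b) {u : ℝ → ℝ}
    (hu : ∀ x, 0 < x → HasDerivAt u (riccatiRHS a b x (u x) / x) x)
    (hu1 : ∀ x, 0 < x → u x < 1) (hu0 : ∀ x, 0 < x → 0 < u x) {x : ℝ} (hx : 0 < x) :
    riccatiRHS a b x (u x) < 1 / 2 := by
  refine riccatiRHS_lt (p := fun _ => 1 / 2) (p' := fun _ => 0) ha hb hu hu1
    hu0 (fun x hx => hasDerivAt_const x _) (fun x hx => by positivity) (fun x hx hq => ?_) hx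
  have h1 := hu1 x hx
  have h0 := hu0 x hx
  have hterm : (b + 2 * a * u x) * (1 / 2 / x) ≤
      (b + 2 * a * u x) * (riccatiRHS a b x (u x) / x) := by gcongr
  unfold riccatiRHS at hq
  -- Half of `1 - u` is below `p = 1/2`; the other half is below `(b + 2au)/(2x)`, since `q ≥ 0`
  -- gives `x(1-u) ≤ bu + au²`.
  have key : x < b + 2 * a * u x + 2 * x * u x := by
    nlinarith [mul_pos hb (sub_pos.2 h1), mul_pos ha h0, mul_pos hx h0,
      mul_pos (mul_pos ha h0) (sub_pos.2 h1)]
  have h3 : u x - 1 + (b + 2 * a * u x) * (1 / 2 / x) + 1 / 2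
      = (b + 2 * a * u x + 2 * x * u x - x) / (2 * x) := by
    field_simp
    ring
  have h4 : 0 < (b + 2 * a * u x + 2 * x * u x - x) / (2 * x) :=
    div_pos (by linarith) (by linarith)
  linarith

/-- Used with `d = -c`. Here `p - q ≤ (1 + 1/d)x`, so the dominating function is a multiple of `x
e^{-x}`. -/
theorem lt_riccatiRHS {a d : ℝ} (ha : 0 < a) (hd : 1 < d) {u : ℝ → ℝ}
    (hu : ∀ x, 0 < x → HasDerivAt u (riccatiRHS a (1 + d) x (u x) / x) x)
    (hu0 : ∀ x, 0 < x → 0 < u x) {x : ℝ} (hx : 0 < x) :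
    x / d - 2 * ((d + a) / (d ^ 2 * (d - 1))) * x ^ 2 < riccatiRHS a (1 + d) x (u x) := by
  have hd0 : 0 < d := by linarith
  have hd1 : 0 < d - 1 := by linarith
  set k := (d + a) / (d ^ 2 * (d - 1)) with hk
  have hk0 : 0 < k := by positivity
  -- This value of `k` makes the terms linear in `u` and `x` combine into `(1 + 2a/d)(u - x/d)`.
  have hkd : k * (d - 1) = 1 / d + a / d ^ 2 := by
    rw [hk]; field_simp
  have hG : Tendsto (fun x : ℝ => (1 + 1 / d) * (x ^ (1 : ℝ) * Real.exp (-1 * x))) atTop (𝓝 0) := by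
    simpa using (tendsto_rpow_mul_exp_neg_mul_atTop_nhds_zero 1 1 one_pos).const_mul (1 + 1 / d)
  have hp : ∀ x : ℝ, HasDerivAt (fun x : ℝ => x / d - 2 * k * x ^ 2) (1 / d - 4 * k * x) x := by
    intro x
    refine (((hasDerivAt_id x).div_const d).sub
      (((hasDerivAt_id x).pow 2).const_mul (2 * k))).congr_deriv ?_
    simp only [id]
    ring
  have h := neg_of_deriv_pos_of_le_tendsto_zero
    (fun x hx => (riccati_sub_mul_exp_hasDerivAt hx (hu x hx) (hp x)).neg)
    (fun x hx hF => ?_) (fun x hx => ?_) hG hx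
  · by_contra! h0
    have : (riccatiRHS a (1 + d) x (u x) - (x / d - 2 * k * x ^ 2)) * Real.exp (-x) ≤ 0 :=
      mul_nonpos_of_nonpos_of_nonneg (by linarith) (Real.exp_pos _).le
    simp only [Pi.neg_apply] at h
    linarith
  · have h0 := hu0 x hx
    have hq : riccatiRHS a (1 + d) x (u x) ≤ x / d - 2 * k * x ^ 2 := by
      simp only [Pi.neg_apply] at hF
      by_contra! hlt
      have := mul_pos (sub_pos.2 hlt) (Real.exp_pos (-x))
      linarith
    rw [← neg_mul]
    refine mul_pos ?_ (Real.exp_pos _)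
    -- If `u ≥ x/d`, then `(1+d)u - x ≥ x/d`, forcing `q > x/d > p`.
    have hux : u x < x / d := by
      by_contra! hle
      have h1 : x * (1 + 1 / d) = (1 + d) * (x / d) := by field_simp; ring
      unfold riccatiRHS at hq
      nlinarith [mul_le_mul_of_nonneg_left hle (by linarith : 0 ≤ 1 + d), mul_pos hx h0,
        mul_pos ha (pow_pos h0 2), mul_pos hk0 (pow_pos hx 2), h1,
        (by ring : x * (1 + 1 / d) = x + x / d)]
    have hterm : (1 + d + 2 * a * u x) * (riccatiRHS a (1 + d) x (u x) / x) ≤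
        (1 + d + 2 * a * u x) * (1 / d - 2 * k * x) := by
      refine mul_le_mul_of_nonneg_left ?_ (by positivity)
      rw [div_le_iff₀ hx]
      refine hq.trans (le_of_eq ?_)
      ring
    have h2 : u x - 1 + (1 + d + 2 * a * u x) * (1 / d - 2 * k * x) - (1 / d - 4 * k * x)
        + (x / d - 2 * k * x ^ 2)
        = (1 + 2 * a / d) * (u x - x / d) - 2 * k * x ^ 2 - 4 * a * k * x * u x := by
      have h3 : (1 + d + 2 * a * u x) * (1 / d - 2 * k * x) = 1 / d + d / d + 2 * a * u x / d
        - 2 * x * (k * (d - 1)) - 4 * k * x - 4 * a * k * x * u x := by ring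
      rw [h3, hkd, div_self hd0.ne']
      ring
    have h3 : 0 < (1 + 2 * a / d) * (x / d - u x) := mul_pos (by positivity) (by linarith)
    have h4 : 0 < k * x ^ 2 := by positivity
    have h5 : 0 < a * k * x * u x := by positivity
    linarith
  · simp only [Pi.neg_apply]
    rw [Real.rpow_one, ← neg_mul, ← mul_assoc, neg_one_mul]
    gcongr
    have h0 := hu0 x hx
    have h1 : 0 < k * x ^ 2 := by positivity
    have h2 : 0 < (x + (1 + d)) * u x + a * u x ^ 2 := by positivity
    unfold riccatiRHS
    have h3 : (1 + 1 / d) * x = x + x / d := by ring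
    linarith

/-! ### Transfer to the Tricomi function and its Turánian. -/

theorem tricomi_of_pos {a : ℝ} (ha : 0 < a) (c x : ℝ) :
    tricomi a c x = kummerIntegral a (c - a - 1) x / Real.Gamma a := by
  rw [tricomi, if_pos ha, kummerIntegral, one_div, div_eq_inv_mul]

theorem tricomi_add_one_of_pos {a : ℝ} (ha : 0 < a) (c x : ℝ) :
    tricomi (a + 1) (c + 1) x = kummerIntegral (a + 1) (c - a - 1) x / (a * Real.Gamma a) := by
  rw [tricomi_of_pos (by linarith), Real.Gamma_add_one ha.ne',
    show c + 1 - (a + 1) - 1 = c - a - 1 by ring]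

theorem tricomi_pos {a c x : ℝ} (ha : 0 < a) (hc : c < 1) (hx : 0 < x) : 0 < tricomi a c x := by
  rw [tricomi_of_pos ha]
  exact div_pos (kummerIntegral_pos ha (by linarith) hx) (Real.Gamma_pos_of_pos ha)

/-- For `a ≤ 1` this is the defining continuation; for `a > 1` it is the three-term relation of the
integrals. -/
theorem tricomi_sub_one {a c x : ℝ} (ha : 0 < a) (hc : c < 1) (hx : 0 < x) :
    tricomi (a - 1) (c - 1) x =
      (x + (1 - c)) * tricomi a c x + a * x * tricomi (a + 1) (c + 1) x := by
  rcases le_or_gt a 1 with h | h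
  · rw [tricomi, if_neg (by linarith), show a - 1 + 1 = a by ring, show c - 1 + 1 = c by ring,
      show a - 1 + 2 = a + 1 by ring, show c - 1 + 2 = c + 1 by ring]
    ring
  · have hG : Real.Gamma a = (a - 1) * Real.Gamma (a - 1) := by
      rw [← Real.Gamma_add_one (by linarith), sub_add_cancel]
    have hG0 : 0 < Real.Gamma (a - 1) := Real.Gamma_pos_of_pos (by linarith)
    have ha1 : 0 < a - 1 := by linarith
    rw [tricomi_add_one_of_pos ha, tricomi_of_pos ha, tricomi_of_pos (by linarith), hG,
      show c - 1 - (a - 1) - 1 = c - a - 1 by ring]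
    have key := kummerIntegral_threeTerm (e := c - a - 1) h (by linarith) hx
    field_simp
    linear_combination key

/-- The function `x ψ(a+1,c+1,x)/ψ(a,c,x)`, that is, minus the logarithmic derivative of `ψ(a,c,·)`
multiplied by `x/a`. -/
noncomputable def tricomiRatio (a c x : ℝ) : ℝ :=
  x * tricomi (a + 1) (c + 1) x / tricomi a c x

theorem tricomiRatio_eq {a : ℝ} (ha : 0 < a) (c x : ℝ) :
    tricomiRatio a c x =
      x * kummerIntegral (a + 1) (c - a - 1) x / (a * kummerIntegral a (c - a - 1) x) := by
  have hG := Real.Gamma_pos_of_pos ha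
  rw [tricomiRatio, tricomi_add_one_of_pos ha, tricomi_of_pos ha]
  field_simp

theorem tricomiRatio_pos {a c x : ℝ} (ha : 0 < a) (hc : c < 1) (hx : 0 < x) :
    0 < tricomiRatio a c x := by
  have h1 := kummerIntegral_pos (e := c - a - 1) ha (by linarith) hx
  have h2 := kummerIntegral_pos (a := a + 1) (e := c - a - 1) (by linarith) (by linarith) hx
  rw [tricomiRatio_eq ha]
  positivity

/-- Integration by parts turns the difference into a positive quotient, which yields `u < 1` and the
rate at which `u → 1`. -/
theorem one_sub_tricomiRatio {a c x : ℝ} (ha : 0 < a) (hc : c < 1) (hx : 0 < x) :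
    1 - tricomiRatio a c x = (a + (1 - c)) / a *
      (kummerIntegral (a + 1) (c - a - 2) x / kummerIntegral a (c - a - 1) x) := by
  have h1 := kummerIntegral_pos (e := c - a - 1) ha (by linarith) hx
  have h2 := kummerIntegral_parts (e := c - a - 1) ha (by linarith) hx
  rw [show c - a - 1 - 1 = c - a - 2 by ring] at h2
  rw [tricomiRatio_eq ha]
  field_simp
  linear_combination -h2

theorem tricomiRatio_lt_one {a c x : ℝ} (ha : 0 < a) (hc : c < 1) (hx : 0 < x) :
    tricomiRatio a c x < 1 := by
  have h1 := kummerIntegral_pos (e := c - a - 1) ha (by linarith) hx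
  have h2 := kummerIntegral_pos (a := a + 1) (e := c - a - 2) (by linarith) (by linarith) hx
  rw [← sub_pos, one_sub_tricomiRatio ha hc hx]
  exact mul_pos (div_pos (by linarith) ha) (div_pos h2 h1)

theorem tricomiRatio_hasDerivAt {a c x : ℝ} (ha : 0 < a) (hc : c < 1) (hx : 0 < x) :
    HasDerivAt (tricomiRatio a c) (riccatiRHS a (1 - c) x (tricomiRatio a c x) / x) x := by
  have hv := kummerIntegral_pos (e := c - a - 1) ha (by linarith) hx
  have h1 := kummerIntegral_hasDerivAt (e := c - a - 1) ha (by linarith) hx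
  have h2 := kummerIntegral_hasDerivAt (a := a + 1) (e := c - a - 1) (by linarith) (by linarith) hx
  have h3 := kummerIntegral_threeTerm (a := a + 1) (e := c - a - 1) (by linarith) (by linarith) hx
  rw [add_sub_cancel_right] at h3
  have hd := ((hasDerivAt_id x).mul h2).div (h1.const_mul a) (by positivity)
  have hfun : tricomiRatio a c = fun x =>
      x * kummerIntegral (a + 1) (c - a - 1) x / (a * kummerIntegral a (c - a - 1) x) :=
    funext fun x => tricomiRatio_eq ha c x
  rw [hfun]
  refine hd.congr_deriv ?_
  simp only [riccatiRHS, id, Pi.mul_apply]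
  field_simp
  linear_combination kummerIntegral a (c - a - 1) x * h3

theorem tricomiTuranian_eq {a c x : ℝ} (ha : 0 < a) (hc : c < 1) (hx : 0 < x) :
    tricomiTuranian a c x =
      -(riccatiRHS a (1 - c) x (tricomiRatio a c x) / x) * tricomi a c x ^ 2 := by
  have hy := tricomi_pos ha hc hx
  rw [tricomiTuranian, tricomi_sub_one ha hc hx, riccatiRHS, tricomiRatio]
  field_simp
  ring

theorem tricomiTuranian_div_sq {a c x : ℝ} (ha : 0 < a) (hc : c < 1) (hx : 0 < x) :
    tricomiTuranian a c x / tricomi a c x ^ 2 =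
      -(riccatiRHS a (1 - c) x (tricomiRatio a c x) / x) := by
  have hy := tricomi_pos ha hc hx
  rw [tricomiTuranian_eq ha hc hx, mul_div_cancel_right₀ _ (by positivity)]

theorem lt_tricomiTuranian {a c x : ℝ} (ha : 0 < a) (hc : c < 1) (hx : 0 < x) :
    (c - a - 1) / x ^ 2 * tricomi a c x ^ 2 < tricomiTuranian a c x := by
  have hy := tricomi_pos ha hc hx
  have h := riccatiRHS_lt_div ha (sub_pos.2 hc) (fun x hx => tricomiRatio_hasDerivAt ha hc hx)
    (fun x hx => tricomiRatio_lt_one ha hc hx) (fun x hx => tricomiRatio_pos ha hc hx) hx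
  rw [tricomiTuranian_eq ha hc hx]
  refine mul_lt_mul_of_pos_right ?_ (by positivity)
  have h2 := div_lt_div_of_pos_right h hx
  rw [show (c - a - 1) / x ^ 2 = -((a + (1 - c)) / x / x) by field_simp; ring]
  linarith

theorem neg_half_lt_tricomiTuranian {a c x : ℝ} (ha : 0 < a) (hc : c < 1) (hx : 0 < x) :
    -(1 / (2 * x)) * tricomi a c x ^ 2 < tricomiTuranian a c x := by
  have hy := tricomi_pos ha hc hx
  have h := riccatiRHS_lt_half ha (sub_pos.2 hc) (fun x hx => tricomiRatio_hasDerivAt ha hc hx)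
    (fun x hx => tricomiRatio_lt_one ha hc hx) (fun x hx => tricomiRatio_pos ha hc hx) hx
  rw [tricomiTuranian_eq ha hc hx]
  refine mul_lt_mul_of_pos_right ?_ (by positivity)
  have h2 := div_lt_div_of_pos_right h hx
  rw [show 1 / (2 * x) = 1 / 2 / x by field_simp]
  linarith

theorem tricomiTuranian_lt {a c x : ℝ} (ha : 0 < a) (hc : c < -1) (hx : 0 < x) :
    tricomiTuranian a c x <
      (1 / c + 2 * x * ((c - a) / (c ^ 2 * (c + 1)))) * tricomi a c x ^ 2 := by
  have hc1 : c < 1 := by linarith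
  have hy := tricomi_pos ha hc1 hx
  have h := lt_riccatiRHS (d := -c) ha (by linarith)
    (fun x hx => by
      rw [← sub_eq_add_neg]
      exact tricomiRatio_hasDerivAt ha hc1 hx)
    (fun x hx => tricomiRatio_pos ha hc1 hx) hx
  rw [← sub_eq_add_neg] at h
  rw [tricomiTuranian_eq ha hc1 hx]
  refine mul_lt_mul_of_pos_right ?_ (by positivity)
  have h2 := div_lt_div_of_pos_right h hx
  have hc0 : c ≠ 0 := by linarith
  have hc2 : c + 1 ≠ 0 := by linarith
  have hc3 : -c - 1 ≠ 0 := by intro h; apply hc2; linarith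
  have h3 : (x / -c - 2 * ((-c + a) / ((-c) ^ 2 * (-c - 1))) * x ^ 2) / x =
      -(1 / c + 2 * x * ((c - a) / (c ^ 2 * (c + 1)))) := by
    rw [show -c - 1 = -(c + 1) by ring, neg_sq]
    field_simp
    ring
  linarith

/-! ### Sharpness: limits at infinity and at zero. -/

theorem tendsto_sq_mul_tricomiTuranian_div {a c : ℝ} (ha : 0 < a) (hc : c < 1) :
    Tendsto (fun x : ℝ => x ^ 2 * tricomiTuranian a c x / tricomi a c x ^ 2) atTop
      (𝓝 (c - a - 1)) := by
  have hA := tendsto_mul_kummerIntegral_div (e := c - a - 1) (e' := c - a - 2) ha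
    (by linarith) (by linarith)
  have hB := tendsto_mul_kummerIntegral_div (e := c - a - 1) (e' := c - a - 3) ha
    (by linarith) (by linarith)
  have hI : Tendsto (fun x : ℝ => x⁻¹) atTop (𝓝 0) := tendsto_inv_atTop_zero
  -- With `s = 1 - u`, `-xq = -((a+b)x - x²s) + (b+2a)xs - a(xs)²/x`; the first bracket is a
  -- difference of divergent terms, here already rewritten through convergent quotients.
  have hlim := (((((hB.const_mul (a + (2 - c))).div_const a).add hA).const_mul (a + (1 - c))).neg).add
    ((((hA.const_mul ((a + (1 - c)) / a)).const_mul (1 - c + 2 * a))).sub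
    (((hA.const_mul ((a + (1 - c)) / a)).pow 2).mul hI |>.const_mul a))
  have hval : -((a + (1 - c)) * ((a + (2 - c)) * a / a + a)) +
      ((1 - c + 2 * a) * ((a + (1 - c)) / a * a) - a * (((a + (1 - c)) / a * a) ^ 2 * 0))
      = c - a - 1 := by
    field_simp
    ring
  rw [hval] at hlim
  refine hlim.congr' ?_
  filter_upwards [eventually_gt_atTop 0] with x hx
  rw [mul_div_assoc (x ^ 2), tricomiTuranian_div_sq ha hc hx]
  have hs := one_sub_tricomiRatio ha hc hx
  have hv := kummerIntegral_pos (e := c - a - 1) ha (by linarith) hx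
  have hp := kummerIntegral_parts (a := a) (e := c - a - 2) ha (by linarith) hx
  have hsp := kummerIntegral_split (a := a) (e := c - a - 1) ha (by linarith) hx
  rw [show c - a - 2 - 1 = c - a - 3 by ring] at hp
  rw [show c - a - 1 - 1 = c - a - 2 by ring] at hsp
  have hu : tricomiRatio a c x = 1 - (a + (1 - c)) / a *
      (kummerIntegral (a + 1) (c - a - 2) x / kummerIntegral a (c - a - 1) x) := by linarith
  rw [hu, riccatiRHS]
  set v := kummerIntegral a (c - a - 1) x
  set A := kummerIntegral (a + 1) (c - a - 2) x
  set B := kummerIntegral (a + 1) (c - a - 3) x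
  -- A second integration by parts resolves the cancellation between `av` and `xA`.
  have hB : (a + (2 - c)) * B = a * (v - A) - x * A := by
    linear_combination hp - a * hsp
  rw [show (a + (2 - c)) * (x * (B / v)) = x * (((a + (2 - c)) * B) / v) by ring, hB]
  field_simp
  ring

theorem tendsto_tricomiTuranian_div_atTop {a c : ℝ} (ha : 0 < a) (hc : c < 1) :
    Tendsto (fun x : ℝ => tricomiTuranian a c x / tricomi a c x ^ 2) atTop (𝓝 0) := by
  have hI : Tendsto (fun x : ℝ => x⁻¹) atTop (𝓝 0) := tendsto_inv_atTop_zero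
  have h := (tendsto_sq_mul_tricomiTuranian_div ha hc).mul (hI.pow 2)
  rw [zero_pow two_ne_zero, mul_zero] at h
  refine h.congr' ?_
  filter_upwards [eventually_gt_atTop 0] with x hx
  field_simp

/-- Drop the positive last term of the three-term relation. To first order at `0` the bound is
`-x/c`, enough for the lower half of the squeeze there. -/
theorem tricomiRatio_le_div {a c x : ℝ} (ha : 0 < a) (hc : c < 0) (hx : 0 < x) :
    tricomiRatio a c x ≤ x / (x - c) := by
  have hv := kummerIntegral_pos (e := c - a - 1) ha (by linarith) hx
  have hw := kummerIntegral_pos (a := a + 2) (e := c - a - 1) (by linarith) (by linarith) hx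
  have h3 := kummerIntegral_threeTerm (a := a + 1) (e := c - a - 1) (by linarith) (by linarith) hx
  rw [add_sub_cancel_right, show a + 1 + 1 = a + 2 by ring] at h3
  rw [tricomiRatio_eq ha, div_le_div_iff₀ (by positivity) (by linarith)]
  nlinarith [mul_pos hx (mul_pos hx hw)]

theorem tendsto_upperBound (a c : ℝ) :
    Tendsto (fun x : ℝ => 1 / c + 2 * x * ((c - a) / (c ^ 2 * (c + 1)))) (𝓝[>] 0)
      (𝓝 (1 / c)) := by
  have h : ContinuousAt (fun x : ℝ => 1 / c + 2 * x * ((c - a) / (c ^ 2 * (c + 1)))) 0 := by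
    fun_prop
  have h2 := h.tendsto
  simp only [mul_zero, zero_mul, add_zero] at h2
  exact h2.mono_left nhdsWithin_le_nhds

theorem tendsto_tricomiTuranian_div_zero {a c : ℝ} (ha : 0 < a) (hc : c < -1) :
    Tendsto (fun x : ℝ => tricomiTuranian a c x / tricomi a c x ^ 2) (𝓝[>] 0) (𝓝 (1 / c)) := by
  have hc1 : c < 1 := by linarith
  have hlow : Tendsto (fun x : ℝ => 1 - (x + (1 - c)) / (x - c) - a * x / (x - c) ^ 2) (𝓝[>] 0)
      (𝓝 (1 / c)) := by
    have hc0 : c ≠ 0 := by linarith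
    have h : ContinuousAt (fun x : ℝ => 1 - (x + (1 - c)) / (x - c) - a * x / (x - c) ^ 2) 0 := by
      have h1 : (0 : ℝ) - c ≠ 0 := by simpa using hc0
      have h2 : ((0 : ℝ) - c) ^ 2 ≠ 0 := pow_ne_zero 2 h1
      fun_prop (disch := assumption)
    have h2 := h.tendsto
    rw [show 1 - ((0 : ℝ) + (1 - c)) / (0 - c) - a * 0 / (0 - c) ^ 2 = 1 / c by
      rw [zero_sub]; field_simp; ring] at h2
    exact h2.mono_left nhdsWithin_le_nhds
  refine tendsto_of_tendsto_of_tendsto_of_le_of_le' hlow (tendsto_upperBound a c) ?_ ?_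
  · filter_upwards [self_mem_nhdsWithin] with x hx
    have hx : 0 < x := hx
    have h0 := tricomiRatio_pos ha hc1 hx
    have h1 := tricomiRatio_le_div (c := c) ha (by linarith) hx
    have hxc : 0 < x - c := by linarith
    have hb : 0 < x + (1 - c) := by linarith
    rw [tricomiTuranian_div_sq ha hc1 hx]
    have h2 : riccatiRHS a (1 - c) x (tricomiRatio a c x) ≤
        (x + (1 - c)) * (x / (x - c)) + a * (x / (x - c)) ^ 2 - x := by
      unfold riccatiRHS
      gcongr
    have h3 := div_le_div_of_nonneg_right h2 hx.le
    have h4 : ((x + (1 - c)) * (x / (x - c)) + a * (x / (x - c)) ^ 2 - x) / x =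
        (x + (1 - c)) / (x - c) + a * x / (x - c) ^ 2 - 1 := by
      field_simp
    linarith
  · filter_upwards [self_mem_nhdsWithin] with x hx
    have hx : 0 < x := hx
    have hy := tricomi_pos ha hc1 hx
    rw [div_le_iff₀ (by positivity)]
    exact (tricomiTuranian_lt ha hc hx).le

theorem theorem1 :
    (∀ a c : ℝ, 0 < a → c < 1 →
      (∀ x : ℝ, 0 < x →
        (c - a - 1) / x ^ 2 * tricomi a c x ^ 2 < tricomiTuranian a c x) ∧
      (∀ x : ℝ, 0 < x →
        -(1 / (2 * x)) * tricomi a c x ^ 2 < tricomiTuranian a c x) ∧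
      Tendsto (fun x : ℝ => tricomiTuranian a c x / tricomi a c x ^ 2) atTop (𝓝 0) ∧
      Tendsto (fun x : ℝ => (c - a - 1) / x ^ 2) atTop (𝓝 0) ∧
      Tendsto (fun x : ℝ => -(1 / (2 * x))) atTop (𝓝 0) ∧
      Tendsto (fun x : ℝ => x ^ 2 * tricomiTuranian a c x / tricomi a c x ^ 2) atTop
        (𝓝 (c - a - 1))) ∧
    (∀ a c : ℝ, 1 < a → c < -1 →
      (∀ x : ℝ, 0 < x →
        tricomiTuranian a c x <
          (1 / c + 2 * x * ((c - a) / (c ^ 2 * (c + 1)))) * tricomi a c x ^ 2) ∧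
      Tendsto (fun x : ℝ => tricomiTuranian a c x / tricomi a c x ^ 2) (𝓝[>] 0) (𝓝 (1 / c)) ∧
      Tendsto (fun x : ℝ => 1 / c + 2 * x * ((c - a) / (c ^ 2 * (c + 1)))) (𝓝[>] 0)
        (𝓝 (1 / c))) := by
  refine ⟨fun a c ha hc => ⟨fun x hx => lt_tricomiTuranian ha hc hx,
    fun x hx => neg_half_lt_tricomiTuranian ha hc hx, tendsto_tricomiTuranian_div_atTop ha hc,
    tendsto_const_nhds.div_atTop (tendsto_pow_atTop two_ne_zero), ?_,
    tendsto_sq_mul_tricomiTuranian_div ha hc⟩, fun a c ha hc => ?_⟩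
  · rw [← neg_zero]
    exact (tendsto_const_nhds.div_atTop (tendsto_id.const_mul_atTop two_pos)).neg
  · have ha0 : 0 < a := by linarith
    exact ⟨fun x hx => tricomiTuranian_lt ha0 hc hx, tendsto_tricomiTuranian_div_zero ha0 hc,
      tendsto_upperBound a c⟩
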